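/- All vectors are in the three-qubit space $\mathcal H=\mathbb C^2\otimes\mathbb C^2\otimes\mathbb C^2$; pure states are unit vectors. A pure state is completely product if it has the form $|\alpha\rangle|\beta\rangle|\gamma\rangle$, and entangled otherwise. An unextendible entangled basis (UEB) is a family of mutually orthonormal entangled pure states such that every pure state in the orthogonal complement of its span is completely product. Say that a pure state $|\Psi\rangle$ satisfies assumption (A) if, in at least one of the three bipartitions "one qubit versus the other two", it can be written as $$|\Psi\rangle=c\,|\alpha\rangle|\Phi\rangle+d\,|\alpha^\perp\rangle|\Phi^\perp\rangle,$$ where $c,d$ are nonzero reals with $c^2+d^2=1$, all vectors are normalized, $\langle\alpha|\alpha^\perp\rangle=0=\langle\Phi|\Phi^\perp\rangle$, $|\Phi\rangle$ is an entangled two-qubit state, $|\Phi^\perp\rangle$ is a two-qubit product state, and $|\Phi^\perp\rangle$ is orthogonal to both product states $|e_0f_0\rangle$, $|e_1f_1\rangle$ of a Schmidt decomposition $|\Phi\rangle=s|e_0f_0\rangle+t|e_1f_1\rangle$ ($s,t$ nonzero reals, $s^2+t^2=1$, $\{e_0,e_1\}$ and $\{f_0,f_1\}$ orthonormal). A member $|\psi_i\rangle$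 of a family $(|\psi_j\rangle)_j$ is locally unambiguously identifiable if there is a three-party LOCC measurement (finitely many rounds of local measurements with broadcast outcomes, local ancillas allowed, or a limit of such measurements) with an outcome that has nonzero probability on $|\psi_i\rangle$ and probability zero on every $|\psi_j\rangle$ with $j\ne i$. **Theorem.** Let $(|\psi_j\rangle)_j$ be a three-qubit UEB, every member of which satisfies (A). Then no member of the UEB is locally unambiguously identifiable. An example is the W-type UEB: for a primitive cube root of unity $\omega$, the six states $$\tfrac1{\sqrt3}(|001\rangle+|010\rangle+|100\rangle),\quad \tfrac1{\sqrt3}(|001\rangle+\omega|010\rangle+\omega^2|100\rangle),\quad \tfrac1{\sqrt3}(|001\rangle+\omega^2|010\rangle+\omega|100\rangle),$$ $$\tfrac1{\sqrt3}(|000\rangle+|101\rangle+|110\rangle),\quad \tfrac1{\sqrt3}(|000\rangle+\omega|101\rangle+\omega^2|110\rangle),\quad \tfrac1{\sqrt3}(|000\rangle+\omega^2|101\rangle+\omega|110\rangle)$$ form a UEB, each of them satisfies (A), and none of them is locally unambiguously identifiable. -/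

import Mathlib

open scoped InnerProductSpace

namespace ThreeQubit

/-- `ℂ^a ⊗ ℂ^b ⊗ ℂ^c` in coordinates: the amplitude of `|x⟩|y⟩|z⟩` is the entry at `(x, y, z)`.
Pure states are unit vectors of this space. -/
abbrev Space (a b c : ℕ) : Type := EuclideanSpace ℂ (Fin a × Fin b × Fin c)

/-- The state space of one qubit. -/
abbrev Qubit : Type := EuclideanSpace ℂ (Fin 2)

/-- The state space of two qubits. -/
abbrev TwoQubits : Type := EuclideanSpace ℂ (Fin 2 × Fin 2)

/-- The state space of three qubits. -/
abbrev ThreeQubits : Type := Space 2 2 2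

/-- The tensor product `|u⟩|v⟩` of two vectors. -/
noncomputable def tensor {I J : Type*} (u : EuclideanSpace ℂ I) (v : EuclideanSpace ℂ J) :
    EuclideanSpace ℂ (I × J) :=
  WithLp.toLp 2 fun x => u x.1 * v x.2

/-- A two-qubit vector is product if it is of the form `|β⟩|γ⟩`. -/
def IsProduct₂ (Φ : TwoQubits) : Prop :=
  ∃ β γ : Qubit, Φ = tensor β γ

/-- A three-qubit vector is completely product if it is of the form `|α⟩|β⟩|γ⟩`. -/
def IsCompletelyProduct (Ψ : ThreeQubits) : Prop :=
  ∃ α β γ : Qubit, Ψ = tensor α (tensor β γ)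

/-- A three-qubit pure state is entangled if it is entangled in at least one bipartition,
i.e. if it is not completely product. -/
def IsEntangled (Ψ : ThreeQubits) : Prop :=
  ‖Ψ‖ = 1 ∧ ¬ IsCompletelyProduct Ψ

/-- `|Φ⊥⟩` is orthogonal to both of the product states that appear in a Schmidt decomposition
`|Φ⟩ = s |e₀⟩|f₀⟩ + t |e₁⟩|f₁⟩` of the entangled two-qubit state `|Φ⟩`. -/
def OrthogonalToSchmidtTerms (Φ Φperp : TwoQubits) : Prop :=
  ∃ (s t : ℝ) (e f : Fin 2 → Qubit),
    s ≠ 0 ∧ t ≠ 0 ∧ s ^ 2 + t ^ 2 = 1 ∧ Orthonormal ℂ e ∧ Orthonormal ℂ f ∧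
    Φ = (s : ℂ) • tensor (e 0) (f 0) + (t : ℂ) • tensor (e 1) (f 1) ∧
    ⟪tensor (e 0) (f 0), Φperp⟫_ℂ = 0 ∧ ⟪tensor (e 1) (f 1), Φperp⟫_ℂ = 0

/-- The assumptions on `|Ψ⟩` in the bipartition "first qubit versus the other two":
`|Ψ⟩ = c |α⟩|Φ⟩ + d |α⊥⟩|Φ⊥⟩` is a Schmidt decomposition with two terms, `|Φ⟩` is entangled,
`|Φ⊥⟩` is product, and `|Φ⊥⟩` is orthogonal to both product states in a Schmidt decomposition
of `|Φ⟩`. -/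
def SatisfiesAssumptionsA (Ψ : ThreeQubits) : Prop :=
  ∃ (c d : ℝ) (α αperp : Qubit) (Φ Φperp : TwoQubits),
    c ≠ 0 ∧ d ≠ 0 ∧ c ^ 2 + d ^ 2 = 1 ∧
    ‖α‖ = 1 ∧ ‖αperp‖ = 1 ∧ ‖Φ‖ = 1 ∧ ‖Φperp‖ = 1 ∧
    ⟪α, αperp⟫_ℂ = 0 ∧ ⟪Φ, Φperp⟫_ℂ = 0 ∧
    Ψ = (c : ℂ) • tensor α Φ + (d : ℂ) • tensor αperp Φperp ∧
    ¬ IsProduct₂ Φ ∧ IsProduct₂ Φperp ∧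
    OrthogonalToSchmidtTerms Φ Φperp

/-- The same vector with the parties listed in the order B, A, C. -/
noncomputable def orderBAC (Ψ : ThreeQubits) : ThreeQubits :=
  WithLp.toLp 2 fun x => Ψ (x.2.1, x.1, x.2.2)

/-- The same vector with the parties listed in the order C, A, B. -/
noncomputable def orderCAB (Ψ : ThreeQubits) : ThreeQubits :=
  WithLp.toLp 2 fun x => Ψ (x.2.1, x.2.2, x.1)

/-- The assumptions on `|Ψ⟩` hold in at least one of the bipartitions A:BC, B:AC, C:AB. -/
def SatisfiesAssumptions (Ψ : ThreeQubits) : Prop :=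
  SatisfiesAssumptionsA Ψ ∨ SatisfiesAssumptionsA (orderBAC Ψ) ∨
    SatisfiesAssumptionsA (orderCAB Ψ)

/-- An unextendible entangled basis of three qubits: mutually orthonormal entangled pure states
such that every pure state in the orthogonal complement of their span is completely product. -/
structure IsUEB {ι : Type*} (v : ι → ThreeQubits) : Prop where
  orthonormal : Orthonormal ℂ v
  entangled : ∀ i, IsEntangled (v i)
  complement : ∀ p ∈ (Submodule.span ℂ (Set.range v))ᗮ, ‖p‖ = 1 → IsCompletelyProduct p

/-! ### Local operations and classical communication -/

/-- The operator `K ⊗ 1 ⊗ 1`. -/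
noncomputable def actA {a a' b c : ℕ} (K : Matrix (Fin a') (Fin a) ℂ) (ψ : Space a b c) :
    Space a' b c :=
  WithLp.toLp 2 fun x => ∑ j, K x.1 j * ψ (j, x.2.1, x.2.2)

/-- The operator `1 ⊗ K ⊗ 1`. -/
noncomputable def actB {a b b' c : ℕ} (K : Matrix (Fin b') (Fin b) ℂ) (ψ : Space a b c) :
    Space a b' c :=
  WithLp.toLp 2 fun x => ∑ j, K x.2.1 j * ψ (x.1, j, x.2.2)

/-- The operator `1 ⊗ 1 ⊗ K`. -/
noncomputable def actC {a b c c' : ℕ} (K : Matrix (Fin c') (Fin c) ℂ) (ψ : Space a b c) :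
    Space a b c' :=
  WithLp.toLp 2 fun x => ∑ j, K x.2.2 j * ψ (x.1, x.2.1, j)

/-- A three-party LOCC protocol with finitely many rounds, on a system with local dimensions
`a`, `b`, `c`, ending in an announcement from `O`. In each round one party performs an arbitrary
local measurement (Kraus operators `K i` with `∑ i, (K i)ᴴ * K i = 1`; the dimension of the local
system may change, so local ancillas are allowed) and broadcasts the outcome `i`, on which
everything that follows may depend. Local operations without an outcome, coarser local instruments
and shared randomness are covered: ignore (part of) the outcome. -/
inductive Protocol (O : Type) : ℕ → ℕ → ℕ → Type
  | announce {a b c : ℕ} (o : O) : Protocol O a b c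
  | measureA {a b c : ℕ} (m : ℕ) (a' : Fin m → ℕ)
      (K : (i : Fin m) → Matrix (Fin (a' i)) (Fin a) ℂ)
      (hK : ∑ i, (K i).conjTranspose * K i = 1)
      (next : (i : Fin m) → Protocol O (a' i) b c) : Protocol O a b c
  | measureB {a b c : ℕ} (m : ℕ) (b' : Fin m → ℕ)
      (K : (i : Fin m) → Matrix (Fin (b' i)) (Fin b) ℂ)
      (hK : ∑ i, (K i).conjTranspose * K i = 1)
      (next : (i : Fin m) → Protocol O a (b' i) c) : Protocol O a b c
  | measureC {a b c : ℕ} (m : ℕ) (c' : Fin m → ℕ)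
      (K : (i : Fin m) → Matrix (Fin (c' i)) (Fin c) ℂ)
      (hK : ∑ i, (K i).conjTranspose * K i = 1)
      (next : (i : Fin m) → Protocol O a b (c' i)) : Protocol O a b c

/-- The probability (Born rule) that the protocol, run on the state `ψ`, announces `o`. -/
noncomputable def Protocol.prob {O : Type} [DecidableEq O] {a b c : ℕ} :
    Protocol O a b c → Space a b c → O → ℝ
  | .announce o', ψ, o => if o' = o then ‖ψ‖ ^ 2 else 0
  | .measureA _ _ K _ next, ψ, o => ∑ i, (next i).prob (actA (K i) ψ) o
  | .measureB _ _ K _ next, ψ, o => ∑ i, (next i).prob (actB (K i) ψ) o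
  | .measureC _ _ K _ next, ψ, o => ∑ i, (next i).prob (actC (K i) ψ) o

/-- `M ψ o` is the probability of announcing `o` on the state `ψ` in an LOCC measurement of three
qubits: a finite-round protocol (take a constant sequence) or a limit of finite-round protocols,
which covers protocols with infinitely many rounds. -/
def IsLOCCMeasurement {O : Type} [DecidableEq O] (M : ThreeQubits → O → ℝ) : Prop :=
  ∃ P : ℕ → Protocol O 2 2 2, ∀ ψ o,
    Filter.Tendsto (fun n => (P n).prob ψ o) Filter.atTop (nhds (M ψ o))

/-- The state `v i` of the known set `v` is locally unambiguously identifiable: some LOCC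
measurement announces `true` ("the state is `v i`") with nonzero probability if the state is `v i`,
and never if it is another state of the set. -/
def LocallyUnambiguouslyIdentifiable {ι : Type*} (v : ι → ThreeQubits) (i : ι) : Prop :=
  ∃ M : ThreeQubits → Bool → ℝ, IsLOCCMeasurement M ∧
    0 < M (v i) true ∧ ∀ j, j ≠ i → M (v j) true = 0

/-! ### The W-type basis -/

/-- The computational basis vector `|xyz⟩`. -/
noncomputable def ket (x y z : Fin 2) : ThreeQubits :=
  EuclideanSpace.single (x, y, z) 1

/-- The W-type unextendible entangled basis; `ω` is a primitive cube root of unity. -/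
noncomputable def wUEB (ω : ℂ) : Fin 6 → ThreeQubits :=
  ![((1 / Real.sqrt 3 : ℝ) : ℂ) • (ket 0 0 1 + ket 0 1 0 + ket 1 0 0),
    ((1 / Real.sqrt 3 : ℝ) : ℂ) • (ket 0 0 1 + ω • ket 0 1 0 + ω ^ 2 • ket 1 0 0),
    ((1 / Real.sqrt 3 : ℝ) : ℂ) • (ket 0 0 1 + ω ^ 2 • ket 0 1 0 + ω • ket 1 0 0),
    ((1 / Real.sqrt 3 : ℝ) : ℂ) • (ket 0 0 0 + ket 1 0 1 + ket 1 1 0),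
    ((1 / Real.sqrt 3 : ℝ) : ℂ) • (ket 0 0 0 + ω • ket 1 0 1 + ω ^ 2 • ket 1 1 0),
    ((1 / Real.sqrt 3 : ℝ) : ℂ) • (ket 0 0 0 + ω ^ 2 • ket 1 0 1 + ω • ket 1 1 0)]

end ThreeQubit

open scoped ComplexConjugate

namespace ThreeQubit

/-! ### States satisfying the assumptions have tensor rank at least three -/

/-! The proof sets tensor rank against product functionals. In a finite-round LOCC protocol, the
probability of an announcement is a sum of squared moduli of product functionals, because each Kraus
operator acts on one tensor factor only. A compactness argument carries this over to limits: if `v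
i` is identifiable, some product functional is nonzero on `v i` and vanishes on all other members
(`LocallyUnambiguouslyIdentifiable.exists_contract`). Let `p` be the product vector representing
this functional. Then `⟪v i, p⟫ • v i - p` is orthogonal to every member, hence completely product
by unextendibility, and so `v i` is a sum of two completely product vectors. Assumption (A) forbids
this (`SatisfiesAssumptions.ne_add`): the determinant on the pencil spanned by `Φ` and `Φ⊥` has a
double root at `Φ⊥`, which for a sum of two products would force `Φ⊥ = 0`. -/

theorem orthonormal_det_ne_zero {e : Fin 2 → Qubit} (he : Orthonormal ℂ e) :
    e 0 0 * e 1 1 - e 0 1 * e 1 0 ≠ 0 := by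
  intro h
  have h0 : ⟪e 0, e 1⟫_ℂ = 0 := he.2 (by decide)
  have n0 : ⟪e 0, e 0⟫_ℂ = 1 := by simp [inner_self_eq_norm_sq_to_K, he.1 0]
  have hz : e 1 ≠ 0 := fun h => by simpa [h] using he.1 1
  simp only [PiLp.inner_apply, RCLike.inner_apply, Fin.sum_univ_two] at h0 n0
  apply hz
  ext i
  fin_cases i
  · simp only [Fin.zero_eta, PiLp.zero_apply]
    linear_combination (-(e 1 0)) * n0 + e 0 0 * h0 - conj (e 0 1) * h
  · simp only [Fin.mk_one, PiLp.zero_apply]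
    linear_combination (-(e 1 1)) * n0 + e 0 1 * h0 + conj (e 0 0) * h

/-- In `ℂ²` the orthogonal complement of a nonzero vector is a line, so `y` and `β` are
proportional. -/
theorem det_eq_zero_of_inner_eq_zero {x y β : Qubit} (hx : x ≠ 0) (hxy : ⟪x, y⟫_ℂ = 0)
    (h : ⟪x, β⟫_ℂ = 0) : y 0 * β 1 - y 1 * β 0 = 0 := by
  by_contra hd
  simp only [PiLp.inner_apply, RCLike.inner_apply, Fin.sum_univ_two] at h hxy
  apply hx
  have h0 : conj (x 0) = 0 := by
    apply (mul_eq_zero.1 (?_ : conj (x 0) * (y 0 * β 1 - y 1 * β 0) = 0)).resolve_right hd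
    linear_combination β 1 * hxy - y 1 * h
  have h1 : conj (x 1) = 0 := by
    apply (mul_eq_zero.1 (?_ : conj (x 1) * (y 0 * β 1 - y 1 * β 0) = 0)).resolve_right hd
    linear_combination y 0 * h - β 0 * hxy
  ext i
  fin_cases i
  · simpa using h0
  · simpa using h1

theorem inner_tensor {I J : Type*} [Fintype I] [Fintype J] (u x : EuclideanSpace ℂ I)
    (v y : EuclideanSpace ℂ J) : ⟪tensor u v, tensor x y⟫_ℂ = ⟪u, x⟫_ℂ * ⟪v, y⟫_ℂ := by
  simp only [PiLp.inner_apply, RCLike.inner_apply, tensor, Fintype.sum_prod_type, map_mul,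
    Finset.sum_mul_sum]
  exact Finset.sum_congr rfl fun i _ => Finset.sum_congr rfl fun j _ => by ring

/-- The polarized determinant of `|Φ⟩` and `|Φ⊥⟩` vanishes, the determinant of `|Φ⟩` does not. -/
theorem OrthogonalToSchmidtTerms.det {Φ Φperp : TwoQubits} (h : OrthogonalToSchmidtTerms Φ Φperp)
    (hp : IsProduct₂ Φperp) :
    Φ (0, 0) * Φ (1, 1) - Φ (0, 1) * Φ (1, 0) ≠ 0 ∧
    Φ (0, 0) * Φperp (1, 1) + Φ (1, 1) * Φperp (0, 0)
      - Φ (0, 1) * Φperp (1, 0) - Φ (1, 0) * Φperp (0, 1) = 0 := by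
  obtain ⟨s, t, e, f, hs, ht, -, he, hf, rfl, h0, h1⟩ := h
  obtain ⟨β, γ, rfl⟩ := hp
  -- Orthogonality of the product states puts `β` on the line of `e j` or `γ` on the line of `f j`.
  -- The product on the left is the polarized determinant of `e j ⊗ f j` and `β ⊗ γ`, so each
  -- Schmidt term contributes zero.
  have key : ∀ i j : Fin 2, i ≠ j → ⟪tensor (e i) (f i), tensor β γ⟫_ℂ = 0 →
      (e j 0 * β 1 - e j 1 * β 0) * (f j 0 * γ 1 - f j 1 * γ 0) = 0 := by
    intro i j hij h
    rw [inner_tensor] at h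
    rcases mul_eq_zero.1 h with h | h
    · rw [det_eq_zero_of_inner_eq_zero (he.ne_zero i) (he.2 hij) h, zero_mul]
    · rw [det_eq_zero_of_inner_eq_zero (hf.ne_zero i) (hf.2 hij) h, mul_zero]
  have k1 := key 0 1 (by decide) h0
  have k0 := key 1 0 (by decide) h1
  have hne : (s : ℂ) * t * ((e 0 0 * e 1 1 - e 0 1 * e 1 0) * (f 0 0 * f 1 1 - f 0 1 * f 1 0)) ≠ 0 :=
    mul_ne_zero (mul_ne_zero (by exact_mod_cast hs) (by exact_mod_cast ht))
      (mul_ne_zero (orthonormal_det_ne_zero he) (orthonormal_det_ne_zero hf))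
  simp only [tensor, PiLp.add_apply, PiLp.smul_apply, smul_eq_mul]
  constructor
  · convert hne using 1
    ring
  · linear_combination (s : ℂ) * k0 + t * k1

/-- Contracting the first qubit with `α` and `α⊥` writes `cΦ` and `dΦ⊥` as combinations of the same
two products `b₁ ⊗ c₁` and `b₂ ⊗ c₂`, on whose span the determinant is a multiple of the product of
the two coefficients. -/
theorem SatisfiesAssumptionsA.ne_add {Ψ P Q : ThreeQubits} (h : SatisfiesAssumptionsA Ψ)
    (hP : IsCompletelyProduct P) (hQ : IsCompletelyProduct Q) : Ψ ≠ P + Q := by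
  intro hΨ
  obtain ⟨c, d, α, α', Φ, Φ', hc, hd, -, hα, hα', -, hΦ', hαα', -, hΨ', -, hprod, hS⟩ := h
  obtain ⟨a₁, b₁, c₁, rfl⟩ := hP
  obtain ⟨a₂, b₂, c₂, rfl⟩ := hQ
  obtain ⟨hdet, hmix⟩ := hS.det hprod
  have hdet' : Φ' (0, 0) * Φ' (1, 1) - Φ' (0, 1) * Φ' (1, 0) = 0 := by
    obtain ⟨β, γ, rfl⟩ := hprod
    simp only [tensor]
    ring
  have hn : ⟪α, α⟫_ℂ = 1 := by simp [inner_self_eq_norm_sq_to_K, hα]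
  have hn' : ⟪α', α'⟫_ℂ = 1 := by simp [inner_self_eq_norm_sq_to_K, hα']
  have hαα'' : ⟪α', α⟫_ℂ = 0 := inner_eq_zero_symm.1 hαα'
  simp only [PiLp.inner_apply, RCLike.inner_apply, Fin.sum_univ_two] at hn hn' hαα' hαα''
  have hx : ∀ x y z, (c : ℂ) * (α x * Φ (y, z)) + d * (α' x * Φ' (y, z)) =
      a₁ x * (b₁ y * c₁ z) + a₂ x * (b₂ y * c₂ z) := by
    intro x y z
    have := congrArg (fun ψ : ThreeQubits => ψ (x, y, z)) (hΨ'.symm.trans hΨ)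
    simpa [tensor] using this
  obtain ⟨A₁, hA₁⟩ : ∃ A, A = conj (α 0) * a₁ 0 + conj (α 1) * a₁ 1 := ⟨_, rfl⟩
  obtain ⟨A₂, hA₂⟩ : ∃ A, A = conj (α 0) * a₂ 0 + conj (α 1) * a₂ 1 := ⟨_, rfl⟩
  obtain ⟨B₁, hB₁⟩ : ∃ A, A = conj (α' 0) * a₁ 0 + conj (α' 1) * a₁ 1 := ⟨_, rfl⟩
  obtain ⟨B₂, hB₂⟩ : ∃ A, A = conj (α' 0) * a₂ 0 + conj (α' 1) * a₂ 1 := ⟨_, rfl⟩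
  have h0 : ∀ y z, (c : ℂ) * Φ (y, z) = A₁ * (b₁ y * c₁ z) + A₂ * (b₂ y * c₂ z) := by
    intro y z
    linear_combination conj (α 0) * hx 0 y z + conj (α 1) * hx 1 y z - c * Φ (y, z) * hn
      - d * Φ' (y, z) * hαα' - (b₁ y * c₁ z) * hA₁ - (b₂ y * c₂ z) * hA₂
  have h1 : ∀ y z, (d : ℂ) * Φ' (y, z) = B₁ * (b₁ y * c₁ z) + B₂ * (b₂ y * c₂ z) := by
    intro y z
    linear_combination conj (α' 0) * hx 0 y z + conj (α' 1) * hx 1 y z - d * Φ' (y, z) * hn'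
      - c * Φ (y, z) * hαα'' - (b₁ y * c₁ z) * hB₁ - (b₂ y * c₂ z) * hB₂
  -- The determinant of `λcΦ + μdΦ⊥` is `(λA₁ + μB₁)(λA₂ + μB₂)D`. The facts `e0`, `e1`, `e2` read
  -- off its coefficients at `λ²`, `μ²`, `λμ`: only the first is nonzero.
  obtain ⟨D, hD⟩ : ∃ D, D = (b₁ 0 * b₂ 1 - b₁ 1 * b₂ 0) * (c₁ 0 * c₂ 1 - c₁ 1 * c₂ 0) := ⟨_, rfl⟩
  have hc' : (c : ℂ) ≠ 0 := by exact_mod_cast hc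
  have hd' : (d : ℂ) ≠ 0 := by exact_mod_cast hd
  have e0 : A₁ * A₂ * D ≠ 0 := by
    have : A₁ * A₂ * D = c * c * (Φ (0, 0) * Φ (1, 1) - Φ (0, 1) * Φ (1, 0)) := by
      have : (c : ℂ) * c * (Φ (0, 0) * Φ (1, 1) - Φ (0, 1) * Φ (1, 0)) =
        (c * Φ (0, 0)) * (c * Φ (1, 1)) - (c * Φ (0, 1)) * (c * Φ (1, 0)) := by ring
      rw [this, hD, h0, h0, h0, h0]
      ring
    rw [this]
    exact mul_ne_zero (mul_ne_zero hc' hc') hdet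
  have e1 : B₁ * B₂ * D = 0 := by
    have : (d * Φ' (0, 0)) * (d * Φ' (1, 1)) - (d * Φ' (0, 1)) * (d * Φ' (1, 0)) = 0 := by
      linear_combination (d : ℂ) * d * hdet'
    rw [h1, h1, h1, h1] at this
    rw [hD]
    linear_combination this
  have e2 : (A₁ * B₂ + B₁ * A₂) * D = 0 := by
    have : (c * Φ (0, 0)) * (d * Φ' (1, 1)) + (c * Φ (1, 1)) * (d * Φ' (0, 0))
        - (c * Φ (0, 1)) * (d * Φ' (1, 0)) - (c * Φ (1, 0)) * (d * Φ' (0, 1)) = 0 := by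
      linear_combination (c : ℂ) * d * hmix
    simp only [h0, h1] at this
    rw [hD]
    linear_combination this
  have hD0 : D ≠ 0 := right_ne_zero_of_mul e0
  have hA₁0 : A₁ ≠ 0 := left_ne_zero_of_mul (left_ne_zero_of_mul e0)
  have hA₂0 : A₂ ≠ 0 := right_ne_zero_of_mul (left_ne_zero_of_mul e0)
  have e2' := (mul_eq_zero.1 e2).resolve_right hD0
  have hB : B₁ = 0 ∧ B₂ = 0 := by
    rcases mul_eq_zero.1 ((mul_eq_zero.1 e1).resolve_right hD0) with h | h
    · simpa [h, hA₁0] using e2'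
    · simpa [h, hA₂0] using e2'
  have hz : Φ' = 0 := by
    ext ⟨y, z⟩
    have := h1 y z
    simpa [hB.1, hB.2, hd'] using this
  simp [hz] at hΦ'

theorem IsCompletelyProduct.orderBAC {P : ThreeQubits} (h : IsCompletelyProduct P) :
    IsCompletelyProduct (orderBAC P) := by
  obtain ⟨α, β, γ, rfl⟩ := h
  refine ⟨β, α, γ, ?_⟩
  ext x
  simp only [ThreeQubit.orderBAC, tensor]
  ring

theorem IsCompletelyProduct.orderCAB {P : ThreeQubits} (h : IsCompletelyProduct P) :
    IsCompletelyProduct (orderCAB P) := by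
  obtain ⟨α, β, γ, rfl⟩ := h
  refine ⟨γ, α, β, ?_⟩
  ext x
  simp only [ThreeQubit.orderCAB, tensor]
  ring

/-- A state satisfying the assumptions is not the sum of two completely product vectors. -/
theorem SatisfiesAssumptions.ne_add {Ψ P Q : ThreeQubits} (h : SatisfiesAssumptions Ψ)
    (hP : IsCompletelyProduct P) (hQ : IsCompletelyProduct Q) : Ψ ≠ P + Q := by
  intro hΨ
  rcases h with h | h | h
  · exact h.ne_add hP hQ hΨ
  · exact h.ne_add hP.orderBAC hQ.orderBAC (by rw [hΨ]; rfl)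
  · exact h.ne_add hP.orderCAB hQ.orderCAB (by rw [hΨ]; rfl)

theorem IsCompletelyProduct.smul {P : ThreeQubits} (h : IsCompletelyProduct P) (r : ℂ) :
    IsCompletelyProduct (r • P) := by
  obtain ⟨α, β, γ, rfl⟩ := h
  refine ⟨r • α, β, γ, ?_⟩
  ext x
  simp [tensor, mul_assoc]

theorem isCompletelyProduct_zero : IsCompletelyProduct 0 :=
  ⟨0, 0, 0, by ext x; simp [tensor]⟩

theorem SatisfiesAssumptions.not_isCompletelyProduct {Ψ : ThreeQubits}
    (h : SatisfiesAssumptions Ψ) : ¬ IsCompletelyProduct Ψ :=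
  fun hp => h.ne_add hp isCompletelyProduct_zero (by simp)

/-! ### Outcomes of LOCC measurements and product functionals -/

/-- The value of the product functional `u ⊗ v ⊗ w` on `ψ`. -/
noncomputable def contract {a b c : ℕ} (u : Fin a → ℂ) (v : Fin b → ℂ) (w : Fin c → ℂ)
    (ψ : Space a b c) : ℂ :=
  ∑ i, ∑ j, ∑ k, u i * v j * w k * ψ (i, j, k)

theorem contract_actA {a a' b c : ℕ} (K : Matrix (Fin a') (Fin a) ℂ) (u : Fin a' → ℂ)
    (v : Fin b → ℂ) (w : Fin c → ℂ) (ψ : Space a b c) :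
    contract u v w (actA K ψ) = contract (Matrix.vecMul u K) v w ψ := by
  simp only [contract, actA, Matrix.vecMul, dotProduct, Finset.mul_sum, Finset.sum_mul]
  calc _ = ∑ i, ∑ j, ∑ l, ∑ k, u i * v j * w k * (K i l * ψ (l, j, k)) :=
        Finset.sum_congr rfl fun i _ => Finset.sum_congr rfl fun j _ => Finset.sum_comm
    _ = ∑ i, ∑ l, ∑ j, ∑ k, u i * v j * w k * (K i l * ψ (l, j, k)) :=
        Finset.sum_congr rfl fun i _ => Finset.sum_comm
    _ = _ := by
        rw [Finset.sum_comm]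
        refine Finset.sum_congr rfl fun l _ => ?_
        rw [Finset.sum_comm]
        refine Finset.sum_congr rfl fun j _ => ?_
        rw [Finset.sum_comm]
        exact Finset.sum_congr rfl fun k _ => Finset.sum_congr rfl fun i _ => by ring

theorem contract_actB {a b b' c : ℕ} (K : Matrix (Fin b') (Fin b) ℂ) (u : Fin a → ℂ)
    (v : Fin b' → ℂ) (w : Fin c → ℂ) (ψ : Space a b c) :
    contract u v w (actB K ψ) = contract u (Matrix.vecMul v K) w ψ := by
  simp only [contract, actB, Matrix.vecMul, dotProduct, Finset.mul_sum, Finset.sum_mul]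
  refine Finset.sum_congr rfl fun i _ => ?_
  calc _ = ∑ j, ∑ l, ∑ k, u i * v j * w k * (K j l * ψ (i, l, k)) :=
        Finset.sum_congr rfl fun j _ => Finset.sum_comm
    _ = _ := by
        rw [Finset.sum_comm]
        refine Finset.sum_congr rfl fun l _ => ?_
        rw [Finset.sum_comm]
        exact Finset.sum_congr rfl fun k _ => Finset.sum_congr rfl fun j _ => by ring

theorem contract_actC {a b c c' : ℕ} (K : Matrix (Fin c') (Fin c) ℂ) (u : Fin a → ℂ)
    (v : Fin b → ℂ) (w : Fin c' → ℂ) (ψ : Space a b c) :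
    contract u v w (actC K ψ) = contract u v (Matrix.vecMul w K) ψ := by
  simp only [contract, actC, Matrix.vecMul, dotProduct, Finset.mul_sum, Finset.sum_mul]
  refine Finset.sum_congr rfl fun i _ => Finset.sum_congr rfl fun j _ => ?_
  rw [Finset.sum_comm]
  exact Finset.sum_congr rfl fun l _ => Finset.sum_congr rfl fun k _ => by ring

theorem contract_single {a b c : ℕ} (i : Fin a) (j : Fin b) (k : Fin c) (ψ : Space a b c) :
    contract (Pi.single i 1) (Pi.single j 1) (Pi.single k 1) ψ = ψ (i, j, k) := by
  simp [contract, Pi.single_apply]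

theorem Space.norm_sq_eq {a b c : ℕ} (ψ : Space a b c) :
    ‖ψ‖ ^ 2 = ∑ i, ∑ j, ∑ k, ‖ψ (i, j, k)‖ ^ 2 := by
  rw [EuclideanSpace.norm_sq_eq, Fintype.sum_prod_type]
  exact Finset.sum_congr rfl fun i _ => Fintype.sum_prod_type _

/-- If a weighted sum of the rank-one forms `|⟨·, x j⟩|²` is nonnegative on all product functionals,
then so is the weighted sum of the probabilities of any outcome of an LOCC protocol. -/
theorem Protocol.sum_prob_nonneg {O : Type} [DecidableEq O] {J : Type*} [Fintype J] (r : J → ℝ)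
    (o : O) {a b c : ℕ} (P : Protocol O a b c) :
    ∀ x : J → Space a b c, (∀ u v w, 0 ≤ ∑ j, r j * ‖contract u v w (x j)‖ ^ 2) →
      0 ≤ ∑ j, r j * P.prob (x j) o := by
  induction P with
  | @announce a b c o' =>
    intro x hx
    simp only [Protocol.prob]
    split_ifs
    · simp only [Space.norm_sq_eq, Finset.mul_sum]
      rw [Finset.sum_comm]
      refine Finset.sum_nonneg fun i _ => ?_
      rw [Finset.sum_comm]
      refine Finset.sum_nonneg fun j _ => ?_
      rw [Finset.sum_comm]
      refine Finset.sum_nonneg fun k _ => ?_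
      -- The squared norm is a sum over coordinates, and each coordinate is itself a product
      -- functional.
      simpa only [contract_single] using hx (Pi.single i 1) (Pi.single j 1) (Pi.single k 1)
    · simp
  | measureA m a' K hK next ih =>
    intro x hx
    simp only [Protocol.prob, Finset.mul_sum]
    rw [Finset.sum_comm]
    -- A Kraus operator is absorbed into the functional of its party, so the hypothesis survives
    -- each branch of the protocol.
    refine Finset.sum_nonneg fun i _ => ih i _ fun u v w => ?_
    simpa only [contract_actA] using hx _ v w
  | measureB m b' K hK next ih =>
    intro x hx
    simp only [Protocol.prob, Finset.mul_sum]
    rw [Finset.sum_comm]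
    refine Finset.sum_nonneg fun i _ => ih i _ fun u v w => ?_
    simpa only [contract_actB] using hx u _ w
  | measureC m c' K hK next ih =>
    intro x hx
    simp only [Protocol.prob, Finset.mul_sum]
    rw [Finset.sum_comm]
    refine Finset.sum_nonneg fun i _ => ih i _ fun u v w => ?_
    simpa only [contract_actC] using hx u v _

/-! ### Probabilities are bounded by the squared norm -/

theorem sum_norm_sq_mulVec {a m : ℕ} {a' : Fin m → ℕ}
    (K : (i : Fin m) → Matrix (Fin (a' i)) (Fin a) ℂ)
    (hK : ∑ i, (K i).conjTranspose * K i = 1) (φ : Fin a → ℂ) :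
    ∑ i, ∑ x, ‖∑ j, K i x j * φ j‖ ^ 2 = ∑ j, ‖φ j‖ ^ 2 := by
  have norm_sq : ∀ {n : ℕ} (y : Fin n → ℂ), ((∑ x, ‖y x‖ ^ 2 : ℝ) : ℂ) = star y ⬝ᵥ y := by
    intro n y
    simp [dotProduct, ← Complex.conj_mul']
  apply Complex.ofReal_injective
  rw [norm_sq, Complex.ofReal_sum]
  calc _ = ∑ i, star φ ⬝ᵥ (((K i).conjTranspose * K i).mulVec φ) := by
        refine Finset.sum_congr rfl fun i _ => ?_
        rw [norm_sq, ← Matrix.mulVec_mulVec, Matrix.dotProduct_mulVec, ← Matrix.star_mulVec]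
        rfl
    _ = _ := by
        rw [← dotProduct_sum, ← Matrix.sum_mulVec, hK, Matrix.one_mulVec]

theorem sum_norm_sq_actA {a b c m : ℕ} {a' : Fin m → ℕ}
    (K : (i : Fin m) → Matrix (Fin (a' i)) (Fin a) ℂ)
    (hK : ∑ i, (K i).conjTranspose * K i = 1) (ψ : Space a b c) :
    ∑ i, ‖actA (K i) ψ‖ ^ 2 = ‖ψ‖ ^ 2 := by
  have swap : ∀ (n : ℕ) (φ : Space n b c),
      ‖φ‖ ^ 2 = ∑ y, ∑ z, ∑ x, ‖φ (x, y, z)‖ ^ 2 := by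
    intro n φ
    rw [Space.norm_sq_eq, Finset.sum_comm]
    exact Finset.sum_congr rfl fun y _ => Finset.sum_comm
  rw [swap, Finset.sum_congr rfl fun i _ => swap _ (actA (K i) ψ), Finset.sum_comm]
  refine Finset.sum_congr rfl fun y _ => ?_
  rw [Finset.sum_comm]
  exact Finset.sum_congr rfl fun z _ => sum_norm_sq_mulVec K hK fun j => ψ (j, y, z)

theorem sum_norm_sq_actB {a b c m : ℕ} {b' : Fin m → ℕ}
    (K : (i : Fin m) → Matrix (Fin (b' i)) (Fin b) ℂ)
    (hK : ∑ i, (K i).conjTranspose * K i = 1) (ψ : Space a b c) :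
    ∑ i, ‖actB (K i) ψ‖ ^ 2 = ‖ψ‖ ^ 2 := by
  have swap : ∀ (n : ℕ) (φ : Space a n c),
      ‖φ‖ ^ 2 = ∑ x, ∑ z, ∑ y, ‖φ (x, y, z)‖ ^ 2 := by
    intro n φ
    rw [Space.norm_sq_eq]
    exact Finset.sum_congr rfl fun x _ => Finset.sum_comm
  rw [swap, Finset.sum_congr rfl fun i _ => swap _ (actB (K i) ψ), Finset.sum_comm]
  refine Finset.sum_congr rfl fun x _ => ?_
  rw [Finset.sum_comm]
  exact Finset.sum_congr rfl fun z _ => sum_norm_sq_mulVec K hK fun j => ψ (x, j, z)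

theorem sum_norm_sq_actC {a b c m : ℕ} {c' : Fin m → ℕ}
    (K : (i : Fin m) → Matrix (Fin (c' i)) (Fin c) ℂ)
    (hK : ∑ i, (K i).conjTranspose * K i = 1) (ψ : Space a b c) :
    ∑ i, ‖actC (K i) ψ‖ ^ 2 = ‖ψ‖ ^ 2 := by
  simp only [Space.norm_sq_eq, actC]
  rw [Finset.sum_comm]
  refine Finset.sum_congr rfl fun x _ => ?_
  rw [Finset.sum_comm]
  exact Finset.sum_congr rfl fun y _ => sum_norm_sq_mulVec K hK fun j => ψ (x, y, j)

theorem Protocol.prob_le {O : Type} [DecidableEq O] (o : O) {a b c : ℕ} (P : Protocol O a b c) :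
    ∀ ψ : Space a b c, P.prob ψ o ≤ ‖ψ‖ ^ 2 := by
  induction P with
  | announce o' =>
    intro ψ
    simp only [Protocol.prob]
    split_ifs
    · exact le_rfl
    · positivity
  | measureA m a' K hK next ih =>
    intro ψ
    rw [← sum_norm_sq_actA K hK ψ]
    exact Finset.sum_le_sum fun i _ => ih i _
  | measureB m b' K hK next ih =>
    intro ψ
    rw [← sum_norm_sq_actB K hK ψ]
    exact Finset.sum_le_sum fun i _ => ih i _
  | measureC m c' K hK next ih =>
    intro ψ
    rw [← sum_norm_sq_actC K hK ψ]
    exact Finset.sum_le_sum fun i _ => ih i _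

/-! ### Compactness and passage to limits of protocols -/

/-- On the compact set where `h ≤ f`, the function `g` cannot vanish, since `f` would vanish too
while `h > 0`; hence `f / g` is bounded there. Elsewhere `f < h`, and any nonnegative constant
works. The slack `h` is needed because `f / g` may blow up near the zeros of `g`. -/
theorem exists_le_mul_add {X : Type*} [TopologicalSpace X] {K : Set X} (hK : IsCompact K)
    {f g h : X → ℝ} (hf : Continuous f) (hg : Continuous g) (hh : Continuous h)
    (hg0 : ∀ x, 0 ≤ g x) (hh0 : ∀ x ∈ K, 0 < h x)
    (hgf : ∀ x ∈ K, g x = 0 → f x = 0) : ∃ C : ℝ, ∀ x ∈ K, f x ≤ C * g x + h x := by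
  have hK' : IsCompact (K ∩ {x | h x ≤ f x}) := hK.inter_right (isClosed_le hh hf)
  have hpos : ∀ x ∈ K ∩ {x | h x ≤ f x}, g x ≠ 0 := by
    rintro x ⟨hx, hx'⟩ h0
    have := hh0 x hx
    rw [Set.mem_ofPred_eq, hgf x hx h0] at hx'
    linarith
  obtain ⟨C, hC⟩ := hK'.bddAbove_image (hf.continuousOn.div hg.continuousOn hpos)
  refine ⟨max C 0, fun x hx => ?_⟩
  by_cases hx' : h x ≤ f x
  · have h1 : f x / g x ≤ C := hC ⟨x, ⟨hx, hx'⟩, rfl⟩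
    have hgx : 0 < g x := (hg0 x).lt_of_ne' (hpos x ⟨hx, hx'⟩)
    rw [div_le_iff₀ hgx] at h1
    nlinarith [le_max_left C 0, hh0 x hx]
  · nlinarith [le_max_right C 0, hg0 x, mul_nonneg (le_max_right C 0) (hg0 x)]

theorem contract_smul {a b c : ℕ} (r s t : ℂ) (u : Fin a → ℂ) (v : Fin b → ℂ) (w : Fin c → ℂ)
    (ψ : Space a b c) :
    contract (r • u) (s • v) (t • w) ψ = r * s * t * contract u v w ψ := by
  simp only [contract, Finset.mul_sum, Pi.smul_apply, smul_eq_mul]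
  exact Finset.sum_congr rfl fun i _ => Finset.sum_congr rfl fun j _ =>
    Finset.sum_congr rfl fun k _ => by ring

theorem contract_eq_zero {a b c : ℕ} {u : Fin a → ℂ} {v : Fin b → ℂ} {w : Fin c → ℂ}
    (h : u = 0 ∨ v = 0 ∨ w = 0) (ψ : Space a b c) : contract u v w ψ = 0 := by
  rcases h with rfl | rfl | rfl <;> simp [contract]

theorem contract_basis {a b c : ℕ} (u : Fin a → ℂ) (v : Fin b → ℂ) (w : Fin c → ℂ)
    (x : Fin a × Fin b × Fin c) :
    contract u v w (EuclideanSpace.single x 1) = u x.1 * v x.2.1 * w x.2.2 := by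
  obtain ⟨i, j, k⟩ := x
  simp only [contract, PiLp.single_apply, Prod.mk.injEq]
  rw [Finset.sum_eq_single i, Finset.sum_eq_single j, Finset.sum_eq_single k] <;>
    simp +contextual

theorem continuous_contract {a b c : ℕ} (ψ : Space a b c) :
    Continuous fun p : (Fin a → ℂ) × (Fin b → ℂ) × (Fin c → ℂ) => contract p.1 p.2.1 p.2.2 ψ := by
  unfold contract
  fun_prop

/-- An unambiguously identifiable state is detected by a product functional that vanishes on the
other states of the set. -/
theorem LocallyUnambiguouslyIdentifiable.exists_contract {ι : Type*} [Finite ι]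
    {v : ι → ThreeQubits} {i : ι} (h : LocallyUnambiguouslyIdentifiable v i) :
    ∃ x y z, contract x y z (v i) ≠ 0 ∧ ∀ j, j ≠ i → contract x y z (v j) = 0 := by
  classical
  have := Fintype.ofFinite ι
  obtain ⟨M, ⟨P, hP⟩, hpos, hzero⟩ := h
  by_contra! hcon
  -- The eight basis states will contribute at most `8ε`, which is half of `M (v i) true`.
  obtain ⟨ε, hε⟩ : ∃ ε, ε = M (v i) true / 16 := ⟨_, rfl⟩
  have hε0 : 0 < ε := by rw [hε]; linarith
  let F := fun (p : (Fin 2 → ℂ) × (Fin 2 → ℂ) × (Fin 2 → ℂ)) (ψ : ThreeQubits) =>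
    ‖contract p.1 p.2.1 p.2.2 ψ‖ ^ 2
  let e := fun x : Fin 2 × Fin 2 × Fin 2 => (EuclideanSpace.single x 1 : ThreeQubits)
  have hF : ∀ ψ, Continuous fun p => F p ψ := fun ψ => ((continuous_contract ψ).norm).pow 2
  have hF0 : ∀ p ψ, 0 ≤ F p ψ := fun p ψ => by positivity
  -- The slack is strictly positive on the product of spheres because a product of nonzero vectors
  -- has a nonzero coordinate.
  obtain ⟨C, hC⟩ := exists_le_mul_add
    (K := Metric.sphere (0 : Fin 2 → ℂ) 1 ×ˢ
      (Metric.sphere (0 : Fin 2 → ℂ) 1 ×ˢ Metric.sphere (0 : Fin 2 → ℂ) 1))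
    ((isCompact_sphere _ _).prod ((isCompact_sphere _ _).prod (isCompact_sphere _ _)))
    (f := fun p => F p (v i)) (g := fun p => ∑ j ∈ Finset.univ.erase i, F p (v j))
    (h := fun p => ε * ∑ x, F p (e x)) (hF _)
    (continuous_finsetSum _ fun j _ => hF _)
    (continuous_const.mul (continuous_finsetSum _ fun j _ => hF _))
    (fun p => Finset.sum_nonneg fun j _ => hF0 _ _)
    (by
      rintro ⟨x, y, z⟩ ⟨hx, hy, hz⟩
      have ne : ∀ u : Fin 2 → ℂ, u ∈ Metric.sphere (0 : Fin 2 → ℂ) 1 → ∃ k, u k ≠ 0 := by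
        intro u hu
        exact Function.ne_iff.1 (ne_zero_of_mem_unit_sphere ⟨u, hu⟩)
      obtain ⟨a, ha⟩ := ne x hx
      obtain ⟨b, hb⟩ := ne y hy
      obtain ⟨c, hc⟩ := ne z hz
      refine mul_pos hε0 (Finset.sum_pos' (fun _ _ => hF0 _ _) ⟨(a, b, c), Finset.mem_univ _, ?_⟩)
      simp only [F, e, contract_basis]
      exact pow_pos (norm_pos_iff.2 (mul_ne_zero (mul_ne_zero ha hb) hc)) 2)
    (by
      rintro ⟨x, y, z⟩ - hg
      rw [Finset.sum_eq_zero_iff_of_nonneg fun _ _ => hF0 _ _] at hg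
      by_contra hne
      obtain ⟨j, hj, hj'⟩ := hcon x y z (fun h => hne (by simp [F, h]))
      have := hg j (by simp [hj])
      simp only [F] at this
      exact hj' (by simpa using this))
  -- All terms scale by the same factor when the three local vectors are rescaled, so the bound
  -- extends from unit vectors to all product functionals.
  have hall : ∀ p, F p (v i) ≤
      C * (∑ j ∈ Finset.univ.erase i, F p (v j)) + ε * ∑ x, F p (e x) := by
    rintro ⟨x, y, z⟩
    by_cases h0 : x = 0 ∨ y = 0 ∨ z = 0
    · simp only [F, contract_eq_zero h0]
      simp
    · push Not at h0
      have unit : ∀ u : Fin 2 → ℂ, u ≠ 0 → ∃ r : ℂ, ∃ u', u' ∈ Metric.sphere (0 : Fin 2 → ℂ) 1 ∧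
          u = r • u' := by
        intro u hu
        refine ⟨(‖u‖ : ℂ), (‖u‖ : ℂ)⁻¹ • u, ?_, ?_⟩
        · simp [norm_smul, norm_ne_zero_iff.2 hu]
        · rw [smul_smul, mul_inv_cancel₀ (by simpa using hu), one_smul]
      obtain ⟨r, x, hx, rfl⟩ := unit x h0.1
      obtain ⟨s, y, hy, rfl⟩ := unit y h0.2.1
      obtain ⟨t, z, hz, rfl⟩ := unit z h0.2.2
      have hs : ∀ ψ, F (r • x, s • y, t • z) ψ = ‖r * s * t‖ ^ 2 * F (x, y, z) ψ := by
        intro ψ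
        simp only [F, contract_smul, norm_mul, mul_pow]
      simp only [hs, ← Finset.mul_sum]
      have := mul_le_mul_of_nonneg_left (hC (x, y, z) ⟨hx, hy, hz⟩) (sq_nonneg ‖r * s * t‖)
      linarith
  have hprob : ∀ n, (P n).prob (v i) true ≤
      C * (∑ j ∈ Finset.univ.erase i, (P n).prob (v j) true) + ε * 8 := by
    intro n
    -- Weight `-1` on `v i`, `C` on the other members and `ε` on the eight basis states turns the
    -- bound on functionals into one on probabilities. Neither `C` nor `ε` depends on `n`.
    have := (P n).sum_prob_nonneg
      (Sum.elim (fun j => if j = i then -1 else C) fun _ : Fin 2 × Fin 2 × Fin 2 => ε) true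
      (Sum.elim v e) (by
        intro x y z
        have := hall (x, y, z)
        simp only [F] at this
        rw [Fintype.sum_sum_type, ← Finset.add_sum_erase _ _ (Finset.mem_univ i),
          Finset.sum_congr rfl fun j hj => by
            rw [Sum.elim_inl, if_neg (Finset.ne_of_mem_erase hj)]]
        simp only [Sum.elim_inl, Sum.elim_inr, if_true, ← Finset.mul_sum]
        linarith)
    rw [Fintype.sum_sum_type, ← Finset.add_sum_erase _ _ (Finset.mem_univ i),
      Finset.sum_congr rfl fun j hj => by
        rw [Sum.elim_inl, if_neg (Finset.ne_of_mem_erase hj)]] at this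
    simp only [Sum.elim_inl, Sum.elim_inr, if_true, ← Finset.mul_sum] at this
    have h8 : ∑ x, (P n).prob (e x) true ≤ 8 :=
      calc _ ≤ ∑ x, ‖e x‖ ^ 2 := Finset.sum_le_sum fun x _ => (P n).prob_le true (e x)
        _ = 8 := by simp [e]
    nlinarith
  have hlim := le_of_tendsto_of_tendsto' (hP (v i) true)
    (((tendsto_finsetSum _ fun j _ => hP (v j) true).const_mul C).add_const (ε * 8)) hprob
  rw [Finset.sum_eq_zero fun j hj => hzero j (Finset.ne_of_mem_erase hj)] at hlim
  linarith

/-! ### Unextendible entangled bases -/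

theorem IsUEB.isCompletelyProduct {ι : Type*} {v : ι → ThreeQubits} (h : IsUEB v)
    {p : ThreeQubits} (hp : ∀ j, ⟪v j, p⟫_ℂ = 0) : IsCompletelyProduct p := by
  by_cases h0 : p = 0
  · rw [h0]
    exact isCompletelyProduct_zero
  have hn : (‖p‖ : ℂ) ≠ 0 := by simpa using h0
  have hu := h.complement ((‖p‖ : ℂ)⁻¹ • p)
    (Submodule.smul_mem _ _ ((Submodule.mem_orthogonal _ _).2 fun u hu => by
      induction hu using Submodule.span_induction with
      | mem x hx =>
        obtain ⟨j, rfl⟩ := hx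
        exact hp j
      | zero => simp
      | add x y _ _ hx hy => rw [inner_add_left, hx, hy, add_zero]
      | smul r x _ hx => rw [inner_smul_left, hx, mul_zero]))
    (by simp [norm_smul, h0])
  have := hu.smul (‖p‖ : ℂ)
  rwa [smul_smul, mul_inv_cancel₀ hn, one_smul] at this

theorem inner_tensor_conj (x y z : Fin 2 → ℂ) (ψ : ThreeQubits) :
    ⟪tensor (WithLp.toLp 2 fun i => conj (x i) : Qubit) (tensor
      (WithLp.toLp 2 fun i => conj (y i) : Qubit) (WithLp.toLp 2 fun i => conj (z i) : Qubit)), ψ⟫_ℂ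
      = contract x y z ψ := by
  simp only [PiLp.inner_apply, RCLike.inner_apply, tensor, Fintype.sum_prod_type, map_mul,
    Complex.conj_conj, contract]
  exact Finset.sum_congr rfl fun i _ => Finset.sum_congr rfl fun j _ =>
    Finset.sum_congr rfl fun k _ => by ring

theorem IsUEB.not_locallyUnambiguouslyIdentifiable {ι : Type*} {v : ι → ThreeQubits}
    (h : IsUEB v) (i : ι) (hA : SatisfiesAssumptions (v i)) :
    ¬ LocallyUnambiguouslyIdentifiable v i := by
  intro hi
  -- Orthonormal families in a finite-dimensional space are finite, so the other members can be
  -- summed over.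
  have : Finite ι := h.orthonormal.linearIndependent.finite
  obtain ⟨x, y, z, hne, hz⟩ := hi.exists_contract
  obtain ⟨p, hp⟩ : ∃ p : ThreeQubits, p = tensor (WithLp.toLp 2 fun i => conj (x i) : Qubit) (tensor
      (WithLp.toLp 2 fun i => conj (y i) : Qubit) (WithLp.toLp 2 fun i => conj (z i) : Qubit)) :=
    ⟨_, rfl⟩
  have hpp : IsCompletelyProduct p := ⟨_, _, _, hp⟩
  have hpi : ⟪v i, p⟫_ℂ ≠ 0 := by
    rw [← inner_conj_symm, hp, inner_tensor_conj]
    simpa using hne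
  have hpj : ∀ j, j ≠ i → ⟪v j, p⟫_ℂ = 0 := by
    intro j hj
    rw [← inner_conj_symm, hp, inner_tensor_conj, hz j hj, map_zero]
  -- The only possible overlap of `p` with the family is along `v i`, and it is subtracted here up
  -- to sign.
  have hq : IsCompletelyProduct (⟪v i, p⟫_ℂ • v i - p) := by
    refine h.isCompletelyProduct fun j => ?_
    rw [inner_sub_right, inner_smul_right]
    by_cases hj : j = i
    · subst hj
      rw [inner_self_eq_norm_sq_to_K, h.orthonormal.1 j]
      simp
    · rw [hpj j hj, h.orthonormal.2 hj]
      simp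
  refine hA.ne_add (hpp.smul (⟪v i, p⟫_ℂ)⁻¹) (hq.smul (⟪v i, p⟫_ℂ)⁻¹) ?_
  rw [← smul_add, add_sub_cancel, smul_smul, inv_mul_cancel₀ hpi, one_smul]

/-! ### The W-type basis -/

/-- The two terms sharing the first-qubit value `a` form `Φ`, with equal Schmidt coefficients and
the phases `x`, `y` absorbed into `e`; the third term gives `Φ⊥`, proportional to `|00⟩`. All six
W-type states have this shape. -/
theorem satisfiesAssumptionsA_of_eq {Ψ : ThreeQubits} {a a' : Fin 2} {x y z : ℂ} (ha : a ≠ a')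
    (hx : ‖x‖ = 1) (hy : ‖y‖ = 1) (hz : ‖z‖ = 1)
    (hΨ : Ψ = ((1 / Real.sqrt 3 : ℝ) : ℂ) • (x • ket a 0 1 + y • ket a 1 0 + z • ket a' 0 0)) :
    SatisfiesAssumptionsA Ψ := by
  obtain ⟨r, hr⟩ : ∃ r, r = Real.sqrt (1 / 2) := ⟨_, rfl⟩
  obtain ⟨c, hc⟩ : ∃ c, c = Real.sqrt (2 / 3) := ⟨_, rfl⟩
  obtain ⟨d, hd⟩ : ∃ d, d = 1 / Real.sqrt 3 := ⟨_, rfl⟩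
  have hr0 : r ≠ 0 := by rw [hr]; positivity
  have hc0 : c ≠ 0 := by rw [hc]; positivity
  have hd0 : d ≠ 0 := by rw [hd]; positivity
  have hr2 : r ^ 2 = 1 / 2 := by rw [hr]; exact Real.sq_sqrt (by norm_num)
  have hc2 : c ^ 2 = 2 / 3 := by rw [hc]; exact Real.sq_sqrt (by norm_num)
  have hd2 : d ^ 2 = 1 / 3 := by rw [hd, div_pow, Real.sq_sqrt (by norm_num)]; norm_num
  -- The three amplitudes agree: `c * r` on the two terms of `Φ` equals `d` on the third.
  have hcr : c * r = d := by
    rw [hc, hr, hd, ← Real.sqrt_mul (by norm_num), one_div (Real.sqrt 3), ← Real.sqrt_inv]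
    norm_num
  have hcrC : (c : ℂ) * r = d := by exact_mod_cast hcr
  have hb : ∀ i : Fin 2, ‖(EuclideanSpace.single i 1 : Qubit)‖ = 1 := fun i => by simp
  let e : Fin 2 → Qubit := ![EuclideanSpace.single 0 x, EuclideanSpace.single 1 y]
  let f : Fin 2 → Qubit := ![EuclideanSpace.single 1 1, EuclideanSpace.single 0 1]
  let Φ : TwoQubits := (r : ℂ) • tensor (e 0) (f 0) + (r : ℂ) • tensor (e 1) (f 1)
  let Φ' : TwoQubits := tensor (EuclideanSpace.single 0 z : Qubit) (EuclideanSpace.single 0 1 : Qubit)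
  have hS : OrthogonalToSchmidtTerms Φ Φ' := by
    refine ⟨r, r, e, f, hr0, hr0, by rw [hr2]; norm_num, ?_, ?_, rfl, ?_, ?_⟩
    · refine ⟨fun i => ?_, fun i j hij => ?_⟩
      · fin_cases i <;> simp [e, hx, hy]
      · fin_cases i <;> fin_cases j <;> simp [e, EuclideanSpace.inner_single_left] at hij ⊢
    · refine ⟨fun i => ?_, fun i j hij => ?_⟩
      · fin_cases i <;> simp [f]
      · fin_cases i <;> fin_cases j <;> simp [f, EuclideanSpace.inner_single_left] at hij ⊢
    · simp [Φ', inner_tensor, e, f, EuclideanSpace.inner_single_left]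
    · simp [Φ', inner_tensor, e, f, EuclideanSpace.inner_single_left]
  have hΦ' : IsProduct₂ Φ' := ⟨_, _, rfl⟩
  refine ⟨c, d, EuclideanSpace.single a 1, EuclideanSpace.single a' 1, Φ, Φ', hc0, hd0,
    by rw [hc2, hd2]; norm_num, hb _, hb _, ?_, ?_, ?_, ?_, ?_, ?_, hΦ', hS⟩
  · rw [← sq_eq_sq₀ (norm_nonneg _) zero_le_one, EuclideanSpace.norm_sq_eq]
    simp [Fintype.sum_prod_type, Φ, e, f, tensor, hx, hy, hr2]
    norm_num
  · rw [← sq_eq_sq₀ (norm_nonneg _) zero_le_one, EuclideanSpace.norm_sq_eq]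
    simp [Fintype.sum_prod_type, Φ', tensor, hz]
  · simp [EuclideanSpace.inner_single_left, ha]
  · simp [Φ, Φ', e, f, inner_tensor,
      EuclideanSpace.inner_single_left]
  · rw [hΨ, ← hd]
    ext ⟨i, j, k⟩
    fin_cases j <;> fin_cases k <;>
      simp [ket, tensor, Φ, Φ', e, f, ← hcrC, PiLp.single_apply, Prod.ext_iff]
    all_goals ring_nf
  · rintro ⟨β, γ, h⟩
    apply (hS.det hΦ').1
    rw [h]
    simp only [tensor]
    ring

theorem wUEB_satisfiesAssumptions {ω : ℂ} (hω : ‖ω‖ = 1) (i : Fin 6) :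
    SatisfiesAssumptions (wUEB ω i) := by
  left
  have h01 : (0 : Fin 2) ≠ 1 := by decide
  have hω2 : ‖ω ^ 2‖ = 1 := by rw [norm_pow, hω, one_pow]
  have h1 : ‖(1 : ℂ)‖ = 1 := norm_one
  fin_cases i
  · exact satisfiesAssumptionsA_of_eq h01 h1 h1 h1 (by simp [wUEB])
  · exact satisfiesAssumptionsA_of_eq h01 h1 hω hω2 (by simp [wUEB])
  · exact satisfiesAssumptionsA_of_eq h01 h1 hω2 hω (by simp [wUEB])
  · exact satisfiesAssumptionsA_of_eq h01.symm h1 h1 h1 (by simp [wUEB]; abel)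
  · exact satisfiesAssumptionsA_of_eq h01.symm hω hω2 h1 (by simp [wUEB]; abel)
  · exact satisfiesAssumptionsA_of_eq h01.symm hω2 hω h1 (by simp [wUEB]; abel)

theorem inner_wUEB {ω : ℂ} (hω : conj ω = ω ^ 2) (ψ : ThreeQubits) (i : Fin 6) :
    ⟪wUEB ω i, ψ⟫_ℂ = (Real.sqrt 3 : ℂ)⁻¹ *
      ![ψ (0, 0, 1) + ψ (0, 1, 0) + ψ (1, 0, 0),
        ψ (0, 0, 1) + ω ^ 2 * ψ (0, 1, 0) + (ω ^ 2) ^ 2 * ψ (1, 0, 0),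
        ψ (0, 0, 1) + (ω ^ 2) ^ 2 * ψ (0, 1, 0) + ω ^ 2 * ψ (1, 0, 0),
        ψ (0, 0, 0) + ψ (1, 0, 1) + ψ (1, 1, 0),
        ψ (0, 0, 0) + ω ^ 2 * ψ (1, 0, 1) + (ω ^ 2) ^ 2 * ψ (1, 1, 0),
        ψ (0, 0, 0) + (ω ^ 2) ^ 2 * ψ (1, 0, 1) + ω ^ 2 * ψ (1, 1, 0)] i := by
  have hket : ∀ x y z, ⟪ket x y z, ψ⟫_ℂ = ψ (x, y, z) := by
    simp [ket, EuclideanSpace.inner_single_left]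
  fin_cases i <;> simp [wUEB, hket, hω] <;> ring

theorem orthonormal_wUEB {ω : ℂ} (hω : conj ω = ω ^ 2) (hsum : 1 + ω + ω ^ 2 = 0) :
    Orthonormal ℂ (wUEB ω) := by
  have hr : (Real.sqrt 3 : ℂ)⁻¹ * (Real.sqrt 3 : ℂ)⁻¹ = 1 / 3 := by
    rw [← mul_inv, ← Complex.ofReal_mul, Real.mul_self_sqrt (by norm_num)]
    norm_num
  rw [orthonormal_iff_ite]
  intro i j
  rw [inner_wUEB hω]
  obtain ⟨r, hr'⟩ : ∃ r, r = (Real.sqrt 3 : ℂ)⁻¹ := ⟨_, rfl⟩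
  rw [← hr'] at hr ⊢
  clear hω
  fin_cases i <;> fin_cases j <;>
    simp [wUEB, ket, ← hr'] <;> clear hr' <;> grind only

theorem isUEB_wUEB {ω : ℂ} (hω : IsPrimitiveRoot ω 3) : IsUEB (wUEB ω) := by
  have hn : ‖ω‖ = 1 := hω.norm'_eq_one (by norm_num)
  have h3 : ω ^ 3 = 1 := hω.pow_eq_one
  have hsum : 1 + ω + ω ^ 2 = 0 := by
    simpa [Finset.sum_range_succ] using hω.geom_sum_eq_zero (by norm_num)
  have hconj : conj ω = ω ^ 2 := by
    have h1 : conj ω * ω = 1 := by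
      rw [Complex.conj_mul', hn]
      simp
    linear_combination ω ^ 2 * h1 - conj ω * h3
  have horth := orthonormal_wUEB hconj hsum
  refine ⟨horth, fun i => ⟨horth.1 i, (wUEB_satisfiesAssumptions hn i).not_isCompletelyProduct⟩, ?_⟩
  intro p hp _
  have hin : ∀ i, ⟪wUEB ω i, p⟫_ℂ = 0 := fun i =>
    (Submodule.mem_orthogonal _ _).1 hp _ (Submodule.subset_span ⟨i, rfl⟩)
  -- This is the invertibility of the Fourier matrix of order three.
  have solve : ∀ {x y z : ℂ}, x + y + z = 0 → x + ω ^ 2 * y + (ω ^ 2) ^ 2 * z = 0 →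
      x + (ω ^ 2) ^ 2 * y + ω ^ 2 * z = 0 → x = 0 ∧ y = 0 ∧ z = 0 := by
    intro x y z h0 h1 h2
    grind
  have hr : (Real.sqrt 3 : ℂ)⁻¹ ≠ 0 := by simp
  have hin' := fun i => (mul_eq_zero.1 ((inner_wUEB hconj p i).symm.trans (hin i))).resolve_left hr
  obtain ⟨a1, a2, a3⟩ := solve (hin' 0) (hin' 1) (hin' 2)
  obtain ⟨b1, b2, b3⟩ := solve (hin' 3) (hin' 4) (hin' 5)
  -- Each of the two triples of states kills three coordinates. Only `|011⟩` and `|111⟩` remain, and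
  -- any combination of them is `|η⟩|1⟩|1⟩`.
  refine ⟨WithLp.toLp 2 fun i => p (i, 1, 1), EuclideanSpace.single 1 1,
    EuclideanSpace.single 1 1, ?_⟩
  ext ⟨i, j, k⟩
  fin_cases i <;> fin_cases j <;> fin_cases k <;> simp [tensor, a1, a2, a3, b1, b2, b3]

end ThreeQubit

theorem theorem2 :
    (∀ (ι : Type*) (v : ι → ThreeQubit.ThreeQubits),
      ThreeQubit.IsUEB v →
      (∀ i, ThreeQubit.SatisfiesAssumptions (v i)) →
      ∀ i, ¬ ThreeQubit.LocallyUnambiguouslyIdentifiable v i) ∧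
    (∀ ω : ℂ, IsPrimitiveRoot ω 3 →
      ThreeQubit.IsUEB (ThreeQubit.wUEB ω) ∧
      (∀ i, ThreeQubit.SatisfiesAssumptions (ThreeQubit.wUEB ω i)) ∧
      ∀ i, ¬ ThreeQubit.LocallyUnambiguouslyIdentifiable (ThreeQubit.wUEB ω) i) := by
  refine ⟨fun ι v hv hA i => hv.not_locallyUnambiguouslyIdentifiable i (hA i), fun ω hω => ?_⟩
  have hA := ThreeQubit.wUEB_satisfiesAssumptions (hω.norm'_eq_one (by norm_num))
  have hv := ThreeQubit.isUEB_wUEB hω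
  exact ⟨hv, hA, fun i => hv.not_locallyUnambiguouslyIdentifiable i (hA i)⟩
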